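/- Let $\beta\in\{1,2\}$. For $n\ge 1$ let $U^{(n)}$ be a random orthogonal ($\beta=1$) or unitary ($\beta=2$) $n\times n$ matrix and let $\Lambda^{(n)}=\operatorname{diag}(\lambda_1^{(n)},\dots,\lambda_n^{(n)})$ be a random real diagonal matrix, all defined on a common probability space $(\Omega,\mathbb P)$. Put $Z^{(n)}=U^{(n)}\Lambda^{(n)}(U^{(n)})^*$, let $f(Z^{(n)})$ be given by the functional calculus, write $\mu(g)=\int g\,d\mu$, and let $\hat\mu^{(n)}=\frac1n\sum_{k=1}^n\delta_{\lambda_k^{(n)}}$, so that $\hat\mu^{(n)}(f)=\frac1n\operatorname{tr}f(Z^{(n)})$. Here $N(0,v)$ is the normal law with mean $0$ and variance $v\ge0$, with $N(0,0)=\delta_0$. Let $f:\mathbb R\to\mathbb R$ be bounded and continuous. Assume: (A1) For every $n$, $U^{(n)}$ and $\Lambda^{(n)}$ are independent, and $U^{(n)}$ is Haar distributed on the orthogonal group ($\beta=1$) or on the unitary group ($\beta=2$). (A2) There is a deterministic probability measure $\nu$ on $\mathbb R$ such that, almost surely as $n\to\infty$, $\hat\mu^{(n)}\to\nu$ weakly,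 $\hat\mu^{(n)}(f)\to\nu(f)$ and $\hat\mu^{(n)}(f^2)\to\nu(f^2)$. Let $\sigma_0^2(f)=\frac2\beta\big(\nu(f^2)-\nu(f)^2\big)$. Then, with all convergences in distribution under $\mathbb P$ as $n\to\infty$: 1. $\sqrt n\,\big(f(Z^{(n)})_{11}-\frac1n\operatorname{tr}f(Z^{(n)})\big)\to N(0,\sigma_0^2(f))$. 2. If in addition $\sqrt n\,\big(\hat\mu^{(n)}(f)-\mathbb E[\hat\mu^{(n)}(f)]\big)\to N(0,\hat\sigma^2)$ for some $\hat\sigma^2\in[0,\infty)$, then $\sqrt n\,\big(f(Z^{(n)})_{11}-\mathbb E[f(Z^{(n)})_{11}]\big)\to N(0,\sigma_0^2(f)+\hat\sigma^2)$. 3. In particular, suppose that (A3) holds: $\operatorname{tr}f(Z^{(n)})-\mathbb E[\operatorname{tr}f(Z^{(n)})]\to N(0,\sigma_1^2)$ for some $\sigma_1^2\in[0,\infty)$. Then the additional assumption in 2 holds with $\hat\sigma^2=0$, and $\sqrt n\,\big(f(Z^{(n)})_{11}-\mathbb E[f(Z^{(n)})_{11}]\big)\to N(0,\sigma_0^2(f))$.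 -/

import Mathlib

open MeasureTheory ProbabilityTheory Filter Topology
open scoped NNReal ENNReal BoundedContinuousFunction

namespace SpectralCLT

/-- The Dyson index `β` of the field `𝕜`: it is `1` for `𝕜 = ℝ` and `2` for `𝕜 = ℂ`. -/
noncomputable def dysonIndex (𝕜 : Type*) [RCLike 𝕜] : ℝ := (Module.finrank ℝ 𝕜 : ℝ)

theorem dysonIndex_real : dysonIndex ℝ = 1 := by simp [dysonIndex]

theorem dysonIndex_complex : dysonIndex ℂ = 2 := by simp [dysonIndex]

/-- The unitary group (`𝕜 = ℂ`) and the orthogonal group (`𝕜 = ℝ`) carry the Borel σ-algebra of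
the topology inherited from the space of matrices. -/
noncomputable instance unitaryGroupMeasurableSpace {𝕜 : Type*} [RCLike 𝕜] {N : ℕ} :
    MeasurableSpace (Matrix.unitaryGroup (Fin N) 𝕜) := borel _

instance unitaryGroupBorelSpace {𝕜 : Type*} [RCLike 𝕜] {N : ℕ} :
    BorelSpace (Matrix.unitaryGroup (Fin N) 𝕜) := ⟨rfl⟩

/-- The matrix `Z = U Λ U*` with eigenvector matrix `U` (unitary for `𝕜 = ℂ`, orthogonal for
`𝕜 = ℝ`) and real diagonal `Λ = diag(lam)`. -/
noncomputable def specMatrix {𝕜 : Type*} [RCLike 𝕜] {N : ℕ}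
    (U : Matrix.unitaryGroup (Fin N) 𝕜) (lam : Fin N → ℝ) : Matrix (Fin N) (Fin N) 𝕜 :=
  (U : Matrix (Fin N) (Fin N) 𝕜) * Matrix.diagonal (fun k => ((lam k : ℝ) : 𝕜)) *
    star (U : Matrix (Fin N) (Fin N) 𝕜)

/-- The upper left entry `f(Z)₁₁`, with `f(Z)` given by the continuous functional calculus, as a
real number. This is `μ₁(f)` for the spectral measure `μ₁` of the pair `(Z, e₁)`;
see `ofReal_entryOne`. -/
noncomputable def entryOne {𝕜 : Type*} [RCLike 𝕜] {N : ℕ} [NeZero N] (f : ℝ → ℝ)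
    (Z : Matrix (Fin N) (Fin N) 𝕜) : ℝ :=
  RCLike.re ((cfc f Z : Matrix (Fin N) (Fin N) 𝕜) 0 0)

/-- The trace `tr f(Z)`, with `f(Z)` given by the continuous functional calculus, as a real
number; see `ofReal_traceFun`. -/
noncomputable def traceFun {𝕜 : Type*} [RCLike 𝕜] {N : ℕ} (f : ℝ → ℝ)
    (Z : Matrix (Fin N) (Fin N) 𝕜) : ℝ :=
  RCLike.re (Matrix.trace (cfc f Z : Matrix (Fin N) (Fin N) 𝕜))

/-- The empirical eigenvalue distribution `(1/N) ∑ₖ δ_{lam k}`. -/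
noncomputable def empiricalMeasure {N : ℕ} [NeZero N] (lam : Fin N → ℝ) : ProbabilityMeasure ℝ :=
  ⟨(N : ℝ≥0∞)⁻¹ • ∑ k, Measure.dirac (lam k), ⟨by
    simp [ENNReal.inv_mul_cancel (Nat.cast_ne_zero.2 (NeZero.ne N)) (ENNReal.natCast_ne_top N)]⟩⟩

/-- `f(U Λ U*) = U f(Λ) U*`. -/
theorem cfc_specMatrix {𝕜 : Type*} [RCLike 𝕜] {N : ℕ} (f : ℝ → ℝ)
    (U : Matrix.unitaryGroup (Fin N) 𝕜) (lam : Fin N → ℝ) :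
    cfc f (specMatrix U lam) = specMatrix U (fun k => f (lam k)) := by
  classical
  let φ : (Fin N → ℝ) →ₐ[ℝ] Matrix (Fin N) (Fin N) 𝕜 :=
    ((Unitary.conjStarAlgAut ℝ (Matrix (Fin N) (Fin N) 𝕜) U).toAlgEquiv.toAlgHom.comp
      (Matrix.diagonalAlgHom ℝ)).comp ((Algebra.ofId ℝ 𝕜).compLeft (Fin N))
  have hφ (d : Fin N → ℝ) : specMatrix U d = φ d := rfl
  let p := Lagrange.interpolate (Finset.univ.image lam) id f
  have hp (k : Fin N) : p.eval (lam k) = f (lam k) :=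
    Lagrange.eval_interpolate_at_node (v := id) f (Function.injective_id.injOn)
      (Finset.mem_image_of_mem _ (Finset.mem_univ k))
  have hsa : IsSelfAdjoint (specMatrix U lam) := by
    unfold specMatrix
    rw [isSelfAdjoint_iff]
    simp only [star_mul, mul_assoc, Matrix.star_eq_conjTranspose, Matrix.conjTranspose_conjTranspose,
      Matrix.diagonal_conjTranspose]
    congr 3
    ext k
    simp
  have hspec : spectrum ℝ (specMatrix U lam) ⊆ Set.range lam := by
    rw [hφ]
    refine (AlgHom.spectrum_apply_subset φ lam).trans ?_
    rw [Pi.spectrum_eq]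
    intro x hx
    obtain ⟨k, hk⟩ := Set.mem_iUnion.1 hx
    rw [spectrum.mem_iff, isUnit_iff_ne_zero, not_not, sub_eq_zero] at hk
    exact ⟨k, hk.symm⟩
  have h1 : cfc f (specMatrix U lam) = cfc p.eval (specMatrix U lam) := by
    refine cfc_congr fun x hx => ?_
    obtain ⟨k, rfl⟩ := hspec hx
    exact (hp k).symm
  rw [h1, cfc_polynomial p _ hsa, hφ, hφ, Polynomial.aeval_algHom_apply]
  congr 1
  ext k
  simp [hp]

/-- `f(U Λ U*)₁₁ = ∑ₖ |U₁ₖ|² f(lam k)`. -/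
theorem ofReal_entryOne {𝕜 : Type*} [RCLike 𝕜] {N : ℕ} [NeZero N] (f : ℝ → ℝ)
    (U : Matrix.unitaryGroup (Fin N) 𝕜) (lam : Fin N → ℝ) :
    (cfc f (specMatrix U lam) : Matrix (Fin N) (Fin N) 𝕜) 0 0 =
        ((entryOne f (specMatrix U lam) : ℝ) : 𝕜) ∧
      entryOne f (specMatrix U lam) =
        ∑ k, ‖(U : Matrix (Fin N) (Fin N) 𝕜) 0 k‖ ^ 2 * f (lam k) := by
  have h : (cfc f (specMatrix U lam) : Matrix (Fin N) (Fin N) 𝕜) 0 0 =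
      ((∑ k, ‖(U : Matrix (Fin N) (Fin N) 𝕜) 0 k‖ ^ 2 * f (lam k) : ℝ) : 𝕜) := by
    rw [cfc_specMatrix, specMatrix, Matrix.mul_apply]
    push_cast
    refine Finset.sum_congr rfl fun k _ => ?_
    rw [Matrix.mul_diagonal, Matrix.star_apply, mul_right_comm, ← RCLike.mul_conj]
    rfl
  have h' : entryOne f (specMatrix U lam) =
      ∑ k, ‖(U : Matrix (Fin N) (Fin N) 𝕜) 0 k‖ ^ 2 * f (lam k) := by
    rw [entryOne, h, RCLike.ofReal_re]
  exact ⟨by rw [h, h'], h'⟩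

/-- `tr f(U Λ U*) = ∑ₖ f(lam k)`. -/
theorem ofReal_traceFun {𝕜 : Type*} [RCLike 𝕜] {N : ℕ} (f : ℝ → ℝ)
    (U : Matrix.unitaryGroup (Fin N) 𝕜) (lam : Fin N → ℝ) :
    Matrix.trace (cfc f (specMatrix U lam) : Matrix (Fin N) (Fin N) 𝕜) =
        ((traceFun f (specMatrix U lam) : ℝ) : 𝕜) ∧
      traceFun f (specMatrix U lam) = ∑ k, f (lam k) := by
  have h : Matrix.trace (cfc f (specMatrix U lam) : Matrix (Fin N) (Fin N) 𝕜) =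
      ((∑ k, f (lam k) : ℝ) : 𝕜) := by
    rw [cfc_specMatrix, specMatrix, Matrix.trace_mul_cycle, Unitary.coe_star_mul_self, one_mul,
      Matrix.trace_diagonal]
    push_cast
    rfl
  have h' : traceFun f (specMatrix U lam) = ∑ k, f (lam k) := by
    rw [traceFun, h, RCLike.ofReal_re]
  exact ⟨by rw [h, h'], h'⟩

/-- `∫ f dμ̂ = (1/N) ∑ₖ f(lam k)`. -/
theorem integral_empiricalMeasure {N : ℕ} [NeZero N] (f : ℝ → ℝ) (lam : Fin N → ℝ) :
    ∫ x, f x ∂(empiricalMeasure lam : Measure ℝ) = (1 / (N : ℝ)) * ∑ k, f (lam k) := by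
  have h : (empiricalMeasure lam : Measure ℝ) =
      (N : ℝ≥0∞)⁻¹ • ∑ k, Measure.dirac (lam k) := rfl
  rw [h, integral_smul_measure, integral_finsetSum_measure fun k _ => integrable_dirac (by simp)]
  simp

/-- The limiting variance `σ₀²(f) = (2/β) (ν(f²) - ν(f)²)`. -/
noncomputable def sigmaZeroSq (𝕜 : Type*) [RCLike 𝕜] (ν : ProbabilityMeasure ℝ) (f : ℝ →ᵇ ℝ) : ℝ :=
  2 / dysonIndex 𝕜 *
    (∫ x, f x ^ 2 ∂(ν : Measure ℝ) - (∫ x, f x ∂(ν : Measure ℝ)) ^ 2)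

/-- The variance is nonnegative, so `Real.toNNReal` does not change it. -/
theorem sigmaZeroSq_nonneg (𝕜 : Type*) [RCLike 𝕜] (ν : ProbabilityMeasure ℝ) (f : ℝ →ᵇ ℝ) :
    0 ≤ sigmaZeroSq 𝕜 ν f := by
  refine mul_nonneg (by unfold dysonIndex; positivity) ?_
  have h := variance_nonneg (fun x => f x) (ν : Measure ℝ)
  rw [variance_eq_sub (MemLp.of_bound f.continuous.aestronglyMeasurable ‖f‖
    (ae_of_all _ f.norm_coe_le_norm))] at h
  simpa using h

/-- Convergence in distribution, under the probability measure `P`, of a sequence of real random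
variables to the normal law `N(0, v)` (the Dirac mass at `0` if `v = 0`). -/
def TendstoNormal {Ω : Type*} [MeasurableSpace Ω] (P : Measure Ω) [IsProbabilityMeasure P]
    (X : ℕ → Ω → ℝ) (v : ℝ≥0) : Prop :=
  TendstoInDistribution X atTop (id : ℝ → ℝ) (fun _ => P) (gaussianReal 0 v)

end SpectralCLT

open SpectralCLT

open SpectralCLT

namespace SpectralCLT

/-! Write N for the size. By `ofReal_entryOne`, f(Z)₁₁ is a weighted mean of the values f(λₖ) with
random weights |U₁ₖ|², which sum to 1. So √N (f(Z)₁₁ - tr f(Z)/N) is √N ∑ₖ |U₁ₖ|² aₖ, where aₖ =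
f(λₖ) - μ̂(f) is centred and bounded by 2‖f‖: this is `rowFluctuation`.

Freeze the eigenvalues. The first row of a Haar matrix is distributed as g/‖g‖ for a standard
Gaussian vector g in 𝕜ᴺ (`map_firstRow_eq`), so the sum becomes (N^(-1/2) ∑ₖ |gₖ|² aₖ) / (‖g‖²/N).
As ∑ aₖ = 0, the |gₖ|² may be centred at no cost. Their variance is 2β, so a central limit theorem
for bounded weights gives the numerator the limit N(0, 2β v), with v = lim (1/N) ∑ aₖ² = ν(f²) -
ν(f)². The denominator tends to β by the strong law, and Slutsky's lemma leaves the variance 2βv/β²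
= (2/β) v = σ₀².

This limit is deterministic and holds for almost every eigenvalue array. Since U and Λ are
independent, the conditional characteristic function of the fluctuation converges to a constant and
factors out of the joint one with any statistic of Λ (`tendsto_integral_cexp_add`). Part 1 takes the
statistic 0. Part 2 takes √N (μ̂(f) - E μ̂(f)): because E|U₁ₖ|² = 1/N, the means of f(Z)₁₁ and μ̂(f)
agree, the decomposition is exact and the variances add. In part 3 that statistic is N^(-1/2) times
the centred trace, so it vanishes in the limit. -/

/-- Telescoping: replace one factor at a time, the remaining factors having modulus at most 1. -/
theorem norm_prod_sub_prod_le {ι : Type*} (s : Finset ι) (a b : ι → ℂ)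
    (ha : ∀ i, ‖a i‖ ≤ 1) (hb : ∀ i, ‖b i‖ ≤ 1) :
    ‖∏ i ∈ s, a i - ∏ i ∈ s, b i‖ ≤ ∑ i ∈ s, ‖a i - b i‖ := by
  classical
  induction s using Finset.induction_on with
  | empty => simp
  | insert i s hi ih =>
    rw [Finset.prod_insert hi, Finset.prod_insert hi, Finset.sum_insert hi]
    have hbs : ‖∏ i ∈ s, b i‖ ≤ 1 := by
      rw [norm_prod]
      exact Finset.prod_le_one (fun _ _ => norm_nonneg _) fun j _ => hb j
    calc ‖a i * ∏ j ∈ s, a j - b i * ∏ j ∈ s, b j‖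
        = ‖(a i - b i) * ∏ j ∈ s, b j + a i * (∏ j ∈ s, a j - ∏ j ∈ s, b j)‖ := by
          congr 1; ring
      _ ≤ ‖a i - b i‖ * ‖∏ j ∈ s, b j‖ + ‖a i‖ * ‖∏ j ∈ s, a j - ∏ j ∈ s, b j‖ := by
          refine (norm_add_le _ _).trans ?_
          rw [norm_mul, norm_mul]
      _ ≤ ‖a i - b i‖ * 1 + 1 * ‖∏ j ∈ s, a j - ∏ j ∈ s, b j‖ := by
          gcongr
          exact ha i
      _ ≤ _ := by linarith

/-! ### Gaussian moments and the squared norm of a standard Gaussian vector -/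

/-- The fourth moment is the fourth derivative at 0 of the moment generating function exp(t²/2). -/
theorem integral_pow_four_gaussianReal : ∫ x, x ^ 4 ∂gaussianReal 0 1 = 3 := by
  have hset : (0 : ℝ) ∈ interior (integrableExpSet (fun x : ℝ => x) (gaussianReal 0 1)) := by
    simp
  have h := iteratedDeriv_mgf_zero hset 4
  have hM : mgf (fun x : ℝ => x) (gaussianReal 0 1) = fun t => Real.exp (t ^ 2 / 2) := by
    rw [mgf_fun_id_gaussianReal]; ext t; simp
  have hexp (t : ℝ) : HasDerivAt (fun t : ℝ => Real.exp (t ^ 2 / 2))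
      (Real.exp (t ^ 2 / 2) * t) t := by
    have := (((hasDerivAt_id t).pow 2).div_const 2).exp
    convert! this using 1
    simp
  -- Each differentiation keeps the factor exp(t²/2) and sends the polynomial p to t p + p'.
  have hd (p p' : ℝ → ℝ) (hp : ∀ t, HasDerivAt p (p' t) t) :
      deriv (fun t : ℝ => Real.exp (t ^ 2 / 2) * p t) =
        fun t => Real.exp (t ^ 2 / 2) * (t * p t + p' t) :=
    funext fun t => by
      refine (((hexp t).mul (hp t)).congr_deriv ?_).deriv
      ring
  have d1 : deriv (fun t : ℝ => Real.exp (t ^ 2 / 2)) = fun t => Real.exp (t ^ 2 / 2) * t :=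
    funext fun t => (hexp t).deriv
  have d2 := hd (fun t => t) _ hasDerivAt_id
  have d3 := hd (fun t => t * t + 1) _
    fun t => ((hasDerivAt_id t).mul (hasDerivAt_id t)).add_const 1
  have d4 := hd (fun t => t * (t * t + 1) + (1 * t + t * 1)) _
    fun t => ((hasDerivAt_id t).mul (((hasDerivAt_id t).mul (hasDerivAt_id t)).add_const 1)).add
      (((hasDerivAt_id t).const_mul 1).add ((hasDerivAt_id t).mul_const 1))
  rw [hM] at h
  simp only [iteratedDeriv_succ, iteratedDeriv_zero, d1] at h
  erw [d2, d3, d4] at h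
  norm_num at h
  exact h.symm

theorem integral_sq_gaussianReal : ∫ x, x ^ 2 ∂gaussianReal 0 1 = 1 := by
  have h := variance_fun_id_gaussianReal (μ := 0) (v := 1)
  rw [variance_eq_integral (by fun_prop)] at h
  simpa using h

theorem memLp_sq_gaussianReal : MemLp (fun x : ℝ => x ^ 2) 2 (gaussianReal 0 1) := by
  rw [memLp_two_iff_integrable_sq (by fun_prop)]
  have h := (memLp_id_gaussianReal (μ := 0) (v := 1) 4).integrable_norm_pow (by norm_num)
  refine h.congr (ae_of_all _ fun x => ?_)
  simp only [id, Real.norm_eq_abs, ← pow_mul]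
  norm_num [Even.pow_abs (show Even 4 by decide)]

theorem variance_sq_gaussianReal : Var[fun x : ℝ => x ^ 2; gaussianReal 0 1] = 2 := by
  rw [variance_eq_sub memLp_sq_gaussianReal, integral_sq_gaussianReal]
  have : ((fun x : ℝ => x ^ 2) ^ 2) = fun x => x ^ 4 := by ext x; simp [← pow_mul]
  rw [this, integral_pow_four_gaussianReal]
  norm_num

section stdGaussian

variable (E : Type*) [NormedAddCommGroup E] [InnerProductSpace ℝ E] [FiniteDimensional ℝ E]
  [MeasurableSpace E] [BorelSpace E]

omit [MeasurableSpace E] [BorelSpace E] in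
theorem norm_sq_sum_smul_stdOrthonormalBasis (x : Fin (Module.finrank ℝ E) → ℝ) :
    ‖∑ i, x i • stdOrthonormalBasis ℝ E i‖ ^ 2 = ∑ i, x i ^ 2 := by
  rw [← (stdOrthonormalBasis ℝ E).sum_sq_norm_inner_right]
  refine Finset.sum_congr rfl fun i _ => ?_
  rw [(stdOrthonormalBasis ℝ E).orthonormal.inner_right_fintype]
  simp

theorem memLp_normSq_stdGaussian : MemLp (fun x : E => ‖x‖ ^ 2) 2 (stdGaussian E) := by
  rw [stdGaussian, memLp_map_measure_iff (by fun_prop) (Measurable.aemeasurable (by fun_prop))]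
  simp only [Function.comp_def, norm_sq_sum_smul_stdOrthonormalBasis]
  refine memLp_finsetSum _ fun i _ => ?_
  exact memLp_sq_gaussianReal.comp_measurePreserving
    (measurePreserving_eval (fun _ : Fin (Module.finrank ℝ E) => gaussianReal 0 1) i)

theorem integral_normSq_stdGaussian :
    ∫ x : E, ‖x‖ ^ 2 ∂stdGaussian E = Module.finrank ℝ E := by
  rw [stdGaussian, integral_map (Measurable.aemeasurable (by fun_prop)) (by fun_prop)]
  simp only [norm_sq_sum_smul_stdOrthonormalBasis]
  rw [integral_finsetSum]
  · have (i : Fin (Module.finrank ℝ E)) :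
        ∫ a : Fin (Module.finrank ℝ E) → ℝ, a i ^ 2 ∂Measure.pi (fun _ => gaussianReal 0 1) = 1 := by
      rw [integral_comp_eval (μ := fun _ : Fin (Module.finrank ℝ E) => gaussianReal 0 1)
        (f := fun x : ℝ => x ^ 2) (by fun_prop), integral_sq_gaussianReal]
    simp [this]
  · intro i _
    exact (memLp_sq_gaussianReal.comp_measurePreserving
      (measurePreserving_eval (fun _ : Fin (Module.finrank ℝ E) => gaussianReal 0 1) i)).integrable
        (by norm_num)

/-- In an orthonormal basis the squared norm is a sum of independent squares of variance 2. For E =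
𝕜 this gives the constant 2β. -/
theorem variance_normSq_stdGaussian :
    Var[fun x : E => ‖x‖ ^ 2; stdGaussian E] = 2 * Module.finrank ℝ E := by
  rw [stdGaussian, variance_map (by fun_prop) (Measurable.aemeasurable (by fun_prop))]
  simp only [Function.comp_def, norm_sq_sum_smul_stdOrthonormalBasis]
  have := variance_sum_pi (μ := fun _ : Fin (Module.finrank ℝ E) => gaussianReal 0 1)
    (X := fun _ x => x ^ 2) (fun _ => memLp_sq_gaussianReal)
  convert! this using 1
  · congr 1; ext; simp
  · simp [variance_sq_gaussianReal, mul_comm]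

theorem ae_ne_zero_stdGaussian [Nontrivial E] : ∀ᵐ x ∂stdGaussian E, x ≠ 0 := by
  have hpos : 0 < Module.finrank ℝ E := Module.finrank_pos
  rw [stdGaussian, ae_map_iff (Measurable.aemeasurable (by fun_prop)) (by measurability)]
  have hae : ∀ᵐ x ∂Measure.pi (fun _ : Fin (Module.finrank ℝ E) => gaussianReal 0 1),
      x ⟨0, hpos⟩ ≠ 0 := by
    have h0 : ∀ᵐ y ∂gaussianReal 0 1, y ≠ 0 := by
      have := nullSingletonClass_gaussianReal (μ := 0) (v := 1) one_ne_zero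
      simp [ae_iff]
    exact (measurePreserving_eval (fun _ : Fin (Module.finrank ℝ E) => gaussianReal 0 1)
      ⟨0, hpos⟩).quasiMeasurePreserving.ae h0
  filter_upwards [hae] with x hx h
  apply hx
  have := norm_sq_sum_smul_stdOrthonormalBasis E x
  rw [h, norm_zero, zero_pow two_ne_zero, eq_comm,
    Finset.sum_eq_zero_iff_of_nonneg fun _ _ => sq_nonneg _] at this
  exact pow_eq_zero_iff two_ne_zero |>.1 (this _ (Finset.mem_univ _))

end stdGaussian

/-! ### Central limit theorem for weighted sums of i.i.d. variables -/

theorem isLittleO_sub_cexp_neg_sq_half {φ : ℝ → ℂ}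
    (hφ : (fun t : ℝ => φ t - (1 - (t : ℂ) ^ 2 / 2)) =o[𝓝 0] fun t : ℝ => t ^ 2) :
    (fun t : ℝ => φ t - Complex.exp (-(t : ℂ) ^ 2 / 2)) =o[𝓝 0] fun t : ℝ => t ^ 2 := by
  have h1 : (fun z : ℂ => Complex.exp z - (1 + z)) =o[𝓝 0] fun z => z := by
    have := (Complex.hasDerivAt_exp 0).isLittleO
    simpa [sub_sub] using this
  have ht : Tendsto (fun t : ℝ => -(t : ℂ) ^ 2 / 2) (𝓝 0) (𝓝 0) := by
    have : Continuous (fun t : ℝ => -(t : ℂ) ^ 2 / 2) := by fun_prop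
    simpa using this.tendsto 0
  have h2 : (fun t : ℝ => Complex.exp (-(t : ℂ) ^ 2 / 2) - (1 + -(t : ℂ) ^ 2 / 2)) =o[𝓝 0]
      fun t : ℝ => t ^ 2 := by
    refine (h1.comp_tendsto ht).trans_isBigO (.of_bound 1 (Eventually.of_forall fun t => ?_))
    simp only [Function.comp_apply, norm_div, norm_neg, norm_pow, Complex.norm_real]
    norm_num
    nlinarith [sq_nonneg t]
  refine (hφ.sub h2).congr_left fun t => ?_
  ring

/-- The bound on the weights makes all arguments c n k * t uniformly small, so each factor may be
replaced by the Gaussian one with error o((c n k * t)²). These errors sum to o(1) because ∑ c² stays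
bounded, and the product of the Gaussian factors depends only on ∑ c². -/
theorem tendsto_prod_of_isLittleO {φ : ℝ → ℂ} (hφ1 : ∀ t, ‖φ t‖ ≤ 1)
    (hφ : (fun t : ℝ => φ t - (1 - (t : ℂ) ^ 2 / 2)) =o[𝓝 0] fun t : ℝ => t ^ 2)
    (c : ∀ n : ℕ, Fin (n + 1) → ℝ) (C s : ℝ)
    (hc : ∀ n k, |c n k| ≤ C / √((n + 1 : ℕ) : ℝ))
    (hs : Tendsto (fun n => ∑ k, c n k ^ 2) atTop (𝓝 s)) (t : ℝ) :
    Tendsto (fun n => ∏ k, φ (c n k * t)) atTop (𝓝 (Complex.exp (-(s * t ^ 2 / 2 : ℝ)))) := by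
  have hE := isLittleO_sub_cexp_neg_sq_half hφ
  have hlim : Tendsto (fun n => ∏ k, Complex.exp (-((c n k * t : ℝ) : ℂ) ^ 2 / 2)) atTop
      (𝓝 (Complex.exp (-(s * t ^ 2 / 2 : ℝ)))) := by
    have h (n : ℕ) : ∏ k, Complex.exp (-((c n k * t : ℝ) : ℂ) ^ 2 / 2) =
        Complex.exp (-((∑ k, c n k ^ 2) * t ^ 2 / 2 : ℝ)) := by
      rw [← Complex.exp_sum]
      congr 1
      push_cast
      rw [Finset.sum_mul, Finset.sum_div, ← Finset.sum_neg_distrib]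
      exact Finset.sum_congr rfl fun k _ => by ring
    simp only [h]
    have hcont : Continuous fun x : ℝ => Complex.exp (-(x * t ^ 2 / 2 : ℝ)) := by fun_prop
    exact (hcont.tendsto s).comp hs
  have hdiff : Tendsto (fun n => ∏ k, φ (c n k * t) -
      ∏ k, Complex.exp (-((c n k * t : ℝ) : ℂ) ^ 2 / 2)) atTop (𝓝 0) := by
    rw [Metric.tendsto_atTop']
    have hC : Tendsto (fun n : ℕ => C / √((n + 1 : ℕ) : ℝ) * |t|) atTop (𝓝 0) := by
      have := (tendsto_const_nhds (x := C)).div_atTop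
        (Real.tendsto_sqrt_atTop.comp (tendsto_natCast_atTop_atTop.comp (tendsto_add_atTop_nat 1)))
      simpa using this.mul_const |t|
    have hs0 : 0 ≤ s := ge_of_tendsto' hs fun n => Finset.sum_nonneg fun _ _ => sq_nonneg _
    intro ε hε
    -- `s + 1` bounds ∑ c² eventually; the final `+ 1` keeps the divisor of ε positive when t = 0
    -- and makes the last inequality strict.
    have hK : 0 < (s + 1) * t ^ 2 + 1 := by positivity
    obtain ⟨δ, hδ, hball⟩ := Metric.eventually_nhds_iff.1 (hE.bound (div_pos hε hK))
    obtain ⟨N, hN⟩ := ((hC.eventually (gt_mem_nhds hδ)).and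
      (hs.eventually (gt_mem_nhds (lt_add_one s)))).exists_forall_of_atTop
    refine ⟨N, fun n hn => ?_⟩
    obtain ⟨h1, h2⟩ := hN n hn.le
    rw [dist_zero_right]
    have hexp1 (k : Fin (n + 1)) : ‖Complex.exp (-((c n k * t : ℝ) : ℂ) ^ 2 / 2)‖ ≤ 1 := by
      have : -((c n k * t : ℝ) : ℂ) ^ 2 / 2 = ((-(c n k * t) ^ 2 / 2 : ℝ) : ℂ) := by push_cast; ring
      rw [this, Complex.norm_exp_ofReal, Real.exp_le_one_iff]
      nlinarith [sq_nonneg (c n k * t)]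
    calc _ ≤ ∑ k, ‖φ (c n k * t) - Complex.exp (-((c n k * t : ℝ) : ℂ) ^ 2 / 2)‖ :=
          norm_prod_sub_prod_le _ _ _ (fun _ => hφ1 _) hexp1
      _ ≤ ∑ k, ε / ((s + 1) * t ^ 2 + 1) * (c n k * t) ^ 2 := by
          refine Finset.sum_le_sum fun k _ => ?_
          have := hball (y := c n k * t) (by
            rw [dist_zero_right, Real.norm_eq_abs, abs_mul]
            exact (mul_le_mul_of_nonneg_right (hc n k) (abs_nonneg t)).trans_lt h1)
          rwa [Real.norm_of_nonneg (sq_nonneg _)] at this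
      _ = ε / ((s + 1) * t ^ 2 + 1) * ((∑ k, c n k ^ 2) * t ^ 2) := by
          rw [Finset.sum_mul, Finset.mul_sum]
          exact Finset.sum_congr rfl fun k _ => by ring
      _ ≤ ε / ((s + 1) * t ^ 2 + 1) * ((s + 1) * t ^ 2) := by gcongr
      _ < ε := by
          rw [div_mul_eq_mul_div, div_lt_iff₀ hK]
          nlinarith
  simpa using hdiff.add hlim

variable {Ω : Type*} {mΩ : MeasurableSpace Ω} {P : Measure Ω} [IsProbabilityMeasure P]

/-- Lévy's continuity theorem, with the characteristic functions written as integrals over Ω. -/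
theorem tendstoNormal_iff {X : ℕ → Ω → ℝ} {v : ℝ≥0} :
    TendstoNormal P X v ↔ (∀ n, AEMeasurable (X n) P) ∧
      ∀ t : ℝ, Tendsto (fun n => ∫ ω, Complex.exp (t * X n ω * Complex.I) ∂P) atTop
        (𝓝 (Complex.exp (-(v * t ^ 2 / 2 : ℝ)))) := by
  have hlim (t : ℝ) : charFun (gaussianReal 0 v) t = Complex.exp (-(v * t ^ 2 / 2 : ℝ)) := by
    simp [charFun_gaussianReal]
  have hX {n : ℕ} (h : AEMeasurable (X n) P) (t : ℝ) :
      charFun (P.map (X n)) t = ∫ ω, Complex.exp (t * X n ω * Complex.I) ∂P := by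
    rw [charFun_apply_real, integral_map h (by fun_prop)]
  constructor
  · intro h
    refine ⟨h.forall_aemeasurable, fun t => ?_⟩
    have := ProbabilityMeasure.tendsto_iff_tendsto_charFun.1 h.tendsto t
    simpa [hX (h.forall_aemeasurable _), hlim] using this
  · rintro ⟨hm, h⟩
    refine ⟨hm, aemeasurable_id, ProbabilityMeasure.tendsto_iff_tendsto_charFun.2 fun t => ?_⟩
    simpa [hX (hm _), hlim] using h t

theorem tendstoNormal_sum_mul {Y : ℕ → Ω → ℝ} (hY : Measurable (Y 0))
    (hident : ∀ k, IdentDistrib (Y k) (Y 0) P P) (hindep : iIndepFun Y P)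
    (h0 : P[Y 0] = 0) (h1 : P[Y 0 ^ 2] = 1)
    (c : ∀ n : ℕ, Fin (n + 1) → ℝ) (C : ℝ) (s : ℝ≥0)
    (hc : ∀ n k, |c n k| ≤ C / √((n + 1 : ℕ) : ℝ))
    (hs : Tendsto (fun n => ∑ k, c n k ^ 2) atTop (𝓝 s)) :
    TendstoNormal P (fun n ω => ∑ k : Fin (n + 1), c n k * Y k ω) s := by
  have hYm (k : ℕ) : AEMeasurable (Y k) P := (hident k).aemeasurable_fst
  have hm (n : ℕ) (k : Fin (n + 1)) : AEMeasurable (fun ω => c n k * Y k ω) P :=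
    (hYm k).const_mul _
  have hmap : IsProbabilityMeasure (P.map (Y 0)) := Measure.isProbabilityMeasure_map hY.aemeasurable
  refine tendstoNormal_iff.2 ⟨fun n => Finset.aemeasurable_fun_sum _ fun k _ => hm n k, fun t => ?_⟩
  have key := tendsto_prod_of_isLittleO (φ := charFun (P.map (Y 0)))
    (fun t => norm_charFun_le_one t) (taylor_charFun_two hY.aemeasurable h0 h1) c C s hc hs t
  refine key.congr fun n => ?_
  have hi : iIndepFun (fun (k : Fin (n + 1)) ω => c n k * Y k ω) P :=
    (hindep.precomp (g := fun k : Fin (n + 1) => (k : ℕ)) Fin.val_injective).comp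
      (fun k x => c n k * x) (fun k => by fun_prop)
  have := congrFun (hi.charFun_map_fun_sum_eq_prod (hm n)) t
  rw [charFun_apply_real, integral_map (Finset.aemeasurable_fun_sum _ fun k _ => hm n k)
    (by fun_prop)] at this
  rw [this, Finset.prod_apply]
  refine Finset.prod_congr rfl fun k _ => ?_
  rw [charFun_map_mul_comp (hYm k), (hident k).map_eq]

/-! ### The law of the first row of a Haar matrix -/

section row

variable {𝕜 : Type*} [RCLike 𝕜] {N : ℕ}

/-- The row vector `x U`. -/
noncomputable def vecMulUnitary (x : EuclideanSpace 𝕜 (Fin N))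
    (U : Matrix.unitaryGroup (Fin N) 𝕜) : EuclideanSpace 𝕜 (Fin N) :=
  WithLp.toLp 2 (Matrix.vecMul (WithLp.ofLp x) (U : Matrix (Fin N) (Fin N) 𝕜))

theorem continuous_vecMulUnitary : Continuous fun p : EuclideanSpace 𝕜 (Fin N) ×
    Matrix.unitaryGroup (Fin N) 𝕜 => vecMulUnitary p.1 p.2 := by
  unfold vecMulUnitary
  refine (PiLp.continuous_toLp 2 _).comp ?_
  exact Continuous.matrix_vecMul (by fun_prop) (by fun_prop)

theorem vecMulUnitary_mul (x : EuclideanSpace 𝕜 (Fin N)) (U V : Matrix.unitaryGroup (Fin N) 𝕜) :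
    vecMulUnitary x (U * V) = vecMulUnitary (vecMulUnitary x U) V := by
  simp [vecMulUnitary, Matrix.vecMul_vecMul]

theorem norm_vecMulUnitary (x : EuclideanSpace 𝕜 (Fin N)) (U : Matrix.unitaryGroup (Fin N) 𝕜) :
    ‖vecMulUnitary x U‖ = ‖x‖ := by
  have h (y : Fin N → 𝕜) : ((‖WithLp.toLp 2 y‖ ^ 2 : ℝ) : 𝕜) = y ⬝ᵥ star y := by
    have := inner_self_eq_norm_sq_to_K (𝕜 := 𝕜) (WithLp.toLp 2 y : EuclideanSpace 𝕜 (Fin N))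
    rw [EuclideanSpace.inner_toLp_toLp] at this
    rw [this]; push_cast; rfl
  have key : ((‖vecMulUnitary x U‖ ^ 2 : ℝ) : 𝕜) = ((‖x‖ ^ 2 : ℝ) : 𝕜) := by
    rw [vecMulUnitary, h, Matrix.star_vecMul, ← Matrix.dotProduct_mulVec, Matrix.mulVec_mulVec,
      ← Matrix.star_eq_conjTranspose, Matrix.mem_unitaryGroup_iff.1 U.2, Matrix.one_mulVec, ← h]
  have := RCLike.ofReal_injective key
  exact (sq_eq_sq₀ (norm_nonneg _) (norm_nonneg _)).1 this

/-- Right multiplication of row vectors by a unitary matrix, as a real linear isometry. -/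
noncomputable def vecMulUnitaryIsometry (U : Matrix.unitaryGroup (Fin N) 𝕜) :
    EuclideanSpace 𝕜 (Fin N) ≃ₗᵢ[ℝ] EuclideanSpace 𝕜 (Fin N) where
  toFun x := vecMulUnitary x U
  invFun x := vecMulUnitary x U⁻¹
  map_add' x y := by simp [vecMulUnitary, Matrix.add_vecMul]
  map_smul' r x := by simp [vecMulUnitary, Matrix.smul_vecMul]
  left_inv x := by
    simp only [← vecMulUnitary_mul, mul_inv_cancel]; simp [vecMulUnitary]
  right_inv x := by
    simp only [← vecMulUnitary_mul, inv_mul_cancel]; simp [vecMulUnitary]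
  norm_map' x := norm_vecMulUnitary x U

/-- The first row of a unitary matrix. -/
noncomputable def firstRow [NeZero N] (U : Matrix.unitaryGroup (Fin N) 𝕜) :
    EuclideanSpace 𝕜 (Fin N) :=
  WithLp.toLp 2 ((U : Matrix (Fin N) (Fin N) 𝕜) 0)

theorem continuous_firstRow [NeZero N] :
    Continuous (firstRow : Matrix.unitaryGroup (Fin N) 𝕜 → EuclideanSpace 𝕜 (Fin N)) := by
  unfold firstRow
  refine (PiLp.continuous_toLp 2 _).comp ?_
  exact (continuous_apply 0).comp continuous_subtype_val

theorem firstRow_mul [NeZero N] (U V : Matrix.unitaryGroup (Fin N) 𝕜) :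
    firstRow (U * V) = vecMulUnitary (firstRow U) V := by
  simp only [firstRow, vecMulUnitary]
  congr 1

theorem exists_firstRow_eq [NeZero N] {x : EuclideanSpace 𝕜 (Fin N)} (hx : ‖x‖ = 1) :
    ∃ U : Matrix.unitaryGroup (Fin N) 𝕜, firstRow U = x := by
  -- The constant family x is orthonormal on the index set {0}, so only the vector at index 0 is
  -- prescribed.
  obtain ⟨b, hb⟩ := Orthonormal.exists_orthonormalBasis_extension_of_card_eq (𝕜 := 𝕜)
    (ι := Fin N) (E := EuclideanSpace 𝕜 (Fin N)) (v := fun _ => x) (s := {0}) (by simp)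
    ⟨fun _ => hx, fun i j hij => (hij (Subsingleton.elim i j)).elim⟩
  refine ⟨⟨Matrix.of fun i j => b i j, ?_⟩, ?_⟩
  · rw [Matrix.mem_unitaryGroup_iff]
    ext i j
    have := orthonormal_iff_ite.1 b.orthonormal j i
    -- The inner product is conjugate linear in its first argument, whence the order j, i above.
    rw [PiLp.inner_apply] at this
    simp only [Matrix.mul_apply, Matrix.star_apply, Matrix.of_apply, Matrix.one_apply]
    simp only [eq_comm (a := i)]
    exact this
  · ext j
    simp [firstRow, hb 0 rfl]

variable [NeZero N] (μ : Measure (Matrix.unitaryGroup (Fin N) 𝕜))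

/-- Take x Gaussian and U from μ independently, and compute the law of (x/‖x‖) U in two ways. For
fixed U it is the law of x/‖x‖, by rotation invariance of the Gaussian. For fixed x ≠ 0 the unit
vector x/‖x‖ is the first row of some unitary W, so (x/‖x‖) U is the first row of W U, distributed
as that of U by left invariance. -/
theorem map_firstRow_eq [IsProbabilityMeasure μ] [μ.IsMulLeftInvariant] :
    μ.map firstRow = (stdGaussian (EuclideanSpace 𝕜 (Fin N))).map
      fun x => (‖x‖⁻¹ : ℝ) • x := by
  have hmeas : Measurable fun x : EuclideanSpace 𝕜 (Fin N) => (‖x‖⁻¹ : ℝ) • x := by fun_prop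
  have hrow : Measurable (firstRow : Matrix.unitaryGroup (Fin N) 𝕜 → _) :=
    continuous_firstRow.measurable
  refine Measure.ext_of_lintegral _ fun f hf => ?_
  rw [lintegral_map hf hrow, lintegral_map hf hmeas]
  have hconst (x : EuclideanSpace 𝕜 (Fin N)) (hx : ‖x‖ = 1) :
      ∫⁻ U, f (vecMulUnitary x U) ∂μ = ∫⁻ U, f (firstRow U) ∂μ := by
    obtain ⟨W, rfl⟩ := exists_firstRow_eq hx
    simp only [← firstRow_mul]
    exact lintegral_mul_left_eq_self (fun U => f (firstRow U)) W
  have hnorm (x : EuclideanSpace 𝕜 (Fin N)) (U : Matrix.unitaryGroup (Fin N) 𝕜) :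
      (‖vecMulUnitary x U‖⁻¹ : ℝ) • vecMulUnitary x U = vecMulUnitary ((‖x‖⁻¹ : ℝ) • x) U := by
    rw [norm_vecMulUnitary]
    exact ((vecMulUnitaryIsometry U).map_smul _ _).symm
  have hinv (U : Matrix.unitaryGroup (Fin N) 𝕜) :
      ∫⁻ x, f ((‖x‖⁻¹ : ℝ) • x) ∂stdGaussian (EuclideanSpace 𝕜 (Fin N)) =
        ∫⁻ x, f (vecMulUnitary ((‖x‖⁻¹ : ℝ) • x) U) ∂stdGaussian (EuclideanSpace 𝕜 (Fin N)) := by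
    conv_lhs => rw [← stdGaussian_map (vecMulUnitaryIsometry U)]
    rw [lintegral_map (f := fun x => f ((‖x‖⁻¹ : ℝ) • x)) (hf.comp hmeas) (vecMulUnitaryIsometry U).continuous.measurable]
    exact lintegral_congr fun x => congrArg f (hnorm x U)
  symm
  calc ∫⁻ x, f ((‖x‖⁻¹ : ℝ) • x) ∂stdGaussian (EuclideanSpace 𝕜 (Fin N))
      = ∫⁻ U, ∫⁻ x, f (vecMulUnitary ((‖x‖⁻¹ : ℝ) • x) U)
          ∂stdGaussian (EuclideanSpace 𝕜 (Fin N)) ∂μ := by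
        simp only [← hinv, lintegral_const, measure_univ, mul_one]
    _ = ∫⁻ x, ∫⁻ U, f (vecMulUnitary ((‖x‖⁻¹ : ℝ) • x) U) ∂μ
          ∂stdGaussian (EuclideanSpace 𝕜 (Fin N)) := by
        refine lintegral_lintegral_swap ?_
        refine (hf.comp (continuous_vecMulUnitary.measurable.comp
          ((hmeas.comp measurable_snd).prodMk measurable_fst))).aemeasurable
    _ = ∫⁻ x, ∫⁻ U, f (firstRow U) ∂μ ∂stdGaussian (EuclideanSpace 𝕜 (Fin N)) := by
        refine lintegral_congr_ae ?_
        filter_upwards [ae_ne_zero_stdGaussian (EuclideanSpace 𝕜 (Fin N))] with x hx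
        exact hconst _ (by rw [norm_smul, norm_inv, norm_norm, inv_mul_cancel₀ (norm_ne_zero_iff.2 hx)])
    _ = ∫⁻ U, f (firstRow U) ∂μ := by simp

theorem sum_norm_sq_firstRow (U : Matrix.unitaryGroup (Fin N) 𝕜) :
    ∑ k, ‖(U : Matrix (Fin N) (Fin N) 𝕜) 0 k‖ ^ 2 = 1 := by
  have h := congrFun (congrFun (Unitary.coe_mul_star_self U) 0) 0
  rw [Matrix.mul_apply, Matrix.one_apply_eq] at h
  have h2 : ((∑ k, ‖(U : Matrix (Fin N) (Fin N) 𝕜) 0 k‖ ^ 2 : ℝ) : 𝕜) = 1 := by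
    rw [← h]
    push_cast
    refine Finset.sum_congr rfl fun k _ => ?_
    rw [Matrix.star_apply, ← RCLike.mul_conj]
    rfl
  exact_mod_cast h2

theorem measurable_norm_sq_entry (k : Fin N) :
    Measurable fun U : Matrix.unitaryGroup (Fin N) 𝕜 =>
      ‖(U : Matrix (Fin N) (Fin N) 𝕜) 0 k‖ ^ 2 :=
  (((EuclideanSpace.proj (𝕜 := 𝕜) k).continuous.comp continuous_firstRow).norm.pow 2).measurable

theorem norm_sq_entry_le_one (U : Matrix.unitaryGroup (Fin N) 𝕜) (k : Fin N) :
    ‖(U : Matrix (Fin N) (Fin N) 𝕜) 0 k‖ ^ 2 ≤ 1 := by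
  rw [← sum_norm_sq_firstRow U]
  exact Finset.single_le_sum (f := fun k => ‖(U : Matrix (Fin N) (Fin N) 𝕜) 0 k‖ ^ 2)
    (fun _ _ => sq_nonneg _) (Finset.mem_univ k)

theorem integrable_norm_sq_entry [IsFiniteMeasure μ] (k : Fin N) :
    Integrable (fun U : Matrix.unitaryGroup (Fin N) 𝕜 =>
      ‖(U : Matrix (Fin N) (Fin N) 𝕜) 0 k‖ ^ 2) μ :=
  Integrable.of_bound (measurable_norm_sq_entry k).aestronglyMeasurable 1
    (ae_of_all _ fun U => by
      rw [Real.norm_of_nonneg (sq_nonneg _)]; exact norm_sq_entry_le_one U k)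

/-- The entries of the row are exchangeable, as coordinate swaps preserve the Gaussian law, and
their squared moduli sum to 1. -/
theorem integral_norm_sq_entry [IsProbabilityMeasure μ] [μ.IsMulLeftInvariant] (k : Fin N) :
    ∫ U, ‖(U : Matrix (Fin N) (Fin N) 𝕜) 0 k‖ ^ 2 ∂μ = 1 / N := by
  have hgauss (k : Fin N) : ∫ U, ‖(U : Matrix (Fin N) (Fin N) 𝕜) 0 k‖ ^ 2 ∂μ =
      ∫ x : EuclideanSpace 𝕜 (Fin N), ‖((‖x‖⁻¹ : ℝ) • x) k‖ ^ 2 ∂stdGaussian _ := by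
    have h1 := integral_map (μ := μ) continuous_firstRow.measurable.aemeasurable
      (f := fun x : EuclideanSpace 𝕜 (Fin N) => ‖x k‖ ^ 2) (by fun_prop)
    have h2 := integral_map (μ := stdGaussian (EuclideanSpace 𝕜 (Fin N)))
      (φ := fun x => (‖x‖⁻¹ : ℝ) • x) (by fun_prop)
      (f := fun x : EuclideanSpace 𝕜 (Fin N) => ‖x k‖ ^ 2) (by fun_prop)
    rw [map_firstRow_eq, h2] at h1
    exact h1.symm
  have hswap (j k : Fin N) : ∫ U, ‖(U : Matrix (Fin N) (Fin N) 𝕜) 0 j‖ ^ 2 ∂μ =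
      ∫ U, ‖(U : Matrix (Fin N) (Fin N) 𝕜) 0 k‖ ^ 2 ∂μ := by
    rw [hgauss, hgauss]
    let e := LinearIsometryEquiv.piLpCongrLeft 2 ℝ 𝕜 (Equiv.swap j k)
    conv_rhs => rw [← stdGaussian_map e]
    rw [integral_map e.continuous.measurable.aemeasurable (by fun_prop)]
    refine integral_congr_ae (ae_of_all _ fun x => ?_)
    simp only [e.norm_map, PiLp.smul_apply]
    simp [e, LinearIsometryEquiv.piLpCongrLeft_apply, Equiv.piCongrLeft'_apply]
  have hsum : ∑ j, ∫ U, ‖(U : Matrix (Fin N) (Fin N) 𝕜) 0 j‖ ^ 2 ∂μ = 1 := by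
    rw [← integral_finsetSum _ fun j _ => integrable_norm_sq_entry μ j]
    simp [sum_norm_sq_firstRow]
  simp only [fun j => hswap j k, Finset.sum_const, Finset.card_univ, Fintype.card_fin,
    nsmul_eq_mul] at hsum
  exact eq_one_div_of_mul_eq_one_right hsum

end row

/-- Slutsky's lemma yields a limit of the form Z = h(G) with G Gaussian; this puts such a limit in
the normal form of `TendstoNormal`. -/
theorem TendstoNormal.of_map_eq {Ω : Type*} [MeasurableSpace Ω] {P : Measure Ω}
    [IsProbabilityMeasure P] {X : ℕ → Ω → ℝ} {Z : ℝ → ℝ} {s v : ℝ≥0}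
    (h : TendstoInDistribution X atTop Z (fun _ => P) (gaussianReal 0 s))
    (hZ : (gaussianReal 0 s).map Z = gaussianReal 0 v) : TendstoNormal P X v where
  forall_aemeasurable := h.forall_aemeasurable
  aemeasurable_limit := aemeasurable_id
  tendsto := by
    convert! h.tendsto using 2
    refine congrArg 𝓝 (Subtype.ext ?_)
    exact Measure.map_id.trans hZ.symm

/-! ### The Gaussian model of the row fluctuation -/

section gaussian

variable (𝕜 : Type*) [RCLike 𝕜]

/-- The law of a sequence of independent standard Gaussian variables with values in `𝕜`. -/
noncomputable def gaussianSequence : Measure (ℕ → 𝕜) :=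
  Measure.infinitePi fun _ : ℕ => stdGaussian 𝕜

instance : IsProbabilityMeasure (gaussianSequence 𝕜) := by
  unfold gaussianSequence; infer_instance

theorem map_eval_gaussianSequence (k : ℕ) :
    (gaussianSequence 𝕜).map (fun g => g k) = stdGaussian 𝕜 :=
  Measure.infinitePi_map_eval _ k

theorem iIndepFun_gaussianSequence {φ : 𝕜 → ℝ} (hφ : Measurable φ) :
    iIndepFun (fun (k : ℕ) g => φ (g k)) (gaussianSequence 𝕜) :=
  iIndepFun_infinitePi fun _ => hφ

theorem identDistrib_gaussianSequence {φ : 𝕜 → ℝ} (hφ : Measurable φ) (k : ℕ) :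
    IdentDistrib (fun g : ℕ → 𝕜 => φ (g k)) (fun g => φ (g 0))
      (gaussianSequence 𝕜) (gaussianSequence 𝕜) := by
  have h : IdentDistrib (fun g : ℕ → 𝕜 => g k) (fun g => g 0)
      (gaussianSequence 𝕜) (gaussianSequence 𝕜) :=
    ⟨(measurable_pi_apply _).aemeasurable, (measurable_pi_apply _).aemeasurable,
      by simp only [map_eval_gaussianSequence]⟩
  exact h.comp hφ

/-- The first `N` terms of a sequence, as a vector. -/
noncomputable def initialVector (N : ℕ) (g : ℕ → 𝕜) : EuclideanSpace 𝕜 (Fin N) :=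
  WithLp.toLp 2 fun k : Fin N => g k

theorem measurable_initialVector (N : ℕ) : Measurable (initialVector 𝕜 N) := by
  unfold initialVector
  exact (PiLp.continuous_toLp 2 _).measurable.comp (by fun_prop)

/-- Realises the Gaussian vectors of all sizes on one probability space, so that the strong law
applies to their norms. -/
theorem map_initialVector (N : ℕ) :
    (gaussianSequence 𝕜).map (initialVector 𝕜 N) = stdGaussian (EuclideanSpace 𝕜 (Fin N)) := by
  have := Measure.isProbabilityMeasure_map (μ := gaussianSequence 𝕜)
    (measurable_initialVector 𝕜 N).aemeasurable
  refine Measure.ext_of_charFun (funext fun t => ?_)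
  have hind : iIndepFun (fun (k : Fin N) (g : ℕ → 𝕜) => g k) (gaussianSequence 𝕜) :=
    (iIndepFun_infinitePi (P := fun _ : ℕ => stdGaussian 𝕜) (X := fun _ x => x)
      fun _ => measurable_id).precomp (g := fun k : Fin N => (k : ℕ)) Fin.val_injective
  have h := (iIndepFun_iff_charFun_pi fun k => (measurable_pi_apply _).aemeasurable).1 hind t
  unfold initialVector
  rw [h, charFun_stdGaussian]
  simp only [map_eval_gaussianSequence, charFun_stdGaussian, ← Complex.exp_sum]
  congr 1
  have hn := EuclideanSpace.norm_sq_eq t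
  rw [← Finset.sum_div, Finset.sum_neg_distrib]
  congr 2
  exact_mod_cast hn.symm

theorem dysonIndex_pos : 0 < dysonIndex 𝕜 := by
  unfold dysonIndex
  exact_mod_cast Module.finrank_pos

theorem integrable_normSq_gaussianSequence :
    Integrable (fun g : ℕ → 𝕜 => ‖g 0‖ ^ 2) (gaussianSequence 𝕜) := by
  have h := (memLp_normSq_stdGaussian 𝕜).integrable (by norm_num)
  rw [← map_eval_gaussianSequence 𝕜 0] at h
  exact h.comp_measurable (by fun_prop)

theorem integral_normSq_gaussianSequence :
    ∫ g : ℕ → 𝕜, ‖g 0‖ ^ 2 ∂gaussianSequence 𝕜 = dysonIndex 𝕜 := by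
  rw [← integral_map (μ := gaussianSequence 𝕜) (φ := fun g : ℕ → 𝕜 => g 0)
    (f := fun x : 𝕜 => ‖x‖ ^ 2) (measurable_pi_apply _).aemeasurable (by fun_prop), map_eval_gaussianSequence,
    integral_normSq_stdGaussian, dysonIndex]

theorem variance_normSq_gaussianSequence :
    ∫ g : ℕ → 𝕜, (‖g 0‖ ^ 2 - dysonIndex 𝕜) ^ 2 ∂gaussianSequence 𝕜 = 2 * dysonIndex 𝕜 := by
  rw [← integral_map (μ := gaussianSequence 𝕜) (φ := fun g : ℕ → 𝕜 => g 0)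
    (f := fun x : 𝕜 => (‖x‖ ^ 2 - dysonIndex 𝕜) ^ 2)
    (measurable_pi_apply _).aemeasurable (by fun_prop),
    map_eval_gaussianSequence]
  have h := variance_normSq_stdGaussian 𝕜
  rw [variance_eq_integral (by fun_prop), integral_normSq_stdGaussian] at h
  exact h

theorem ae_tendsto_mean_normSq :
    ∀ᵐ g ∂gaussianSequence 𝕜, Tendsto
      (fun n : ℕ => (∑ k : Fin (n + 1), ‖g k‖ ^ 2) / ((n + 1 : ℕ) : ℝ)) atTop
      (𝓝 (dysonIndex 𝕜)) := by
  have hφ : Measurable fun x : 𝕜 => ‖x‖ ^ 2 := by fun_prop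
  have h := strong_law_ae_real (fun (k : ℕ) (g : ℕ → 𝕜) => ‖g k‖ ^ 2)
    (integrable_normSq_gaussianSequence 𝕜)
    (fun i j hij => (iIndepFun_gaussianSequence 𝕜 hφ).indepFun hij)
    (identDistrib_gaussianSequence 𝕜 hφ)
  filter_upwards [h] with g hg
  rw [integral_normSq_gaussianSequence] at hg
  refine (hg.comp (tendsto_add_atTop_nat 1)).congr fun n => ?_
  simp only [Function.comp_apply]
  rw [Finset.sum_range]

variable (a : ∀ n : ℕ, Fin (n + 1) → ℝ) (C : ℝ) (v : ℝ≥0)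

/-- Since the weights sum to zero, ‖g k‖² may be replaced by ‖g k‖² - β, which has variance 2β. -/
theorem tendstoNormal_sum_normSq (ha : ∀ n k, |a n k| ≤ C) (ha0 : ∀ n, ∑ k, a n k = 0)
    (hv : Tendsto (fun n : ℕ => (1 / ((n + 1 : ℕ) : ℝ)) * ∑ k, a n k ^ 2) atTop (𝓝 v)) :
    TendstoNormal (gaussianSequence 𝕜)
      (fun n g => (√((n + 1 : ℕ) : ℝ))⁻¹ * ∑ k : Fin (n + 1), ‖g k‖ ^ 2 * a n k)
      ((2 * dysonIndex 𝕜).toNNReal * v) := by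
  have hβ := dysonIndex_pos 𝕜
  set β := dysonIndex 𝕜 with hβdef
  set r := √(2 * β) with hr
  have hr0 : 0 < r := Real.sqrt_pos.2 (by positivity)
  have hr2 : r ^ 2 = 2 * β := Real.sq_sqrt (by positivity)
  have hφ : Measurable fun x : 𝕜 => (‖x‖ ^ 2 - β) / r := by fun_prop
  have h := tendstoNormal_sum_mul (P := gaussianSequence 𝕜)
    (Y := fun k g => (‖g k‖ ^ 2 - β) / r) (by fun_prop)
    (identDistrib_gaussianSequence 𝕜 hφ) (iIndepFun_gaussianSequence 𝕜 hφ)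
    (by
      rw [integral_div, integral_sub (integrable_normSq_gaussianSequence 𝕜) (integrable_const _),
        integral_normSq_gaussianSequence]
      simp [hβdef])
    (by
      simp only [Pi.pow_apply, div_pow]
      rw [integral_div, variance_normSq_gaussianSequence, hr2]
      exact div_self (by positivity))
    -- The factor r = √(2β) undoes the standardisation of the summands.
    (fun n k => r * a n k / √((n + 1 : ℕ) : ℝ)) (r * C) ((2 * β).toNNReal * v)
    (fun n k => by
      rw [abs_div, abs_mul, abs_of_pos hr0, abs_of_nonneg (Real.sqrt_nonneg _)]
      gcongr
      exact ha n k)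
    (by
      have h2 := hv.const_mul (2 * β)
      rw [NNReal.coe_mul, Real.coe_toNNReal _ (by positivity)]
      refine h2.congr fun n => ?_
      simp only [div_pow, mul_pow, hr2, Real.sq_sqrt (Nat.cast_nonneg (n + 1))]
      rw [← Finset.sum_div, ← Finset.mul_sum]
      ring)
  convert! h using 3 with n g
  rw [Finset.mul_sum]
  have h3 : ∑ k : Fin (n + 1), r * a n k / √((n + 1 : ℕ) : ℝ) * ((‖g k‖ ^ 2 - β) / r) =
      ∑ k : Fin (n + 1), (√((n + 1 : ℕ) : ℝ))⁻¹ * (‖g k‖ ^ 2 * a n k) -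
        (√((n + 1 : ℕ) : ℝ))⁻¹ * β * ∑ k, a n k := by
    rw [Finset.mul_sum, ← Finset.sum_sub_distrib]
    refine Finset.sum_congr rfl fun k _ => ?_
    field_simp
  rw [h3, ha0, mul_zero, sub_zero]

/-- Slutsky's lemma: the unnormalised sum is multiplied by the inverse of ‖g‖²/N, which tends almost
surely to 1/β. The variance changes from 2βv to 2v/β. -/
theorem tendstoNormal_normalized (ha : ∀ n k, |a n k| ≤ C) (ha0 : ∀ n, ∑ k, a n k = 0)
    (hv : Tendsto (fun n : ℕ => (1 / ((n + 1 : ℕ) : ℝ)) * ∑ k, a n k ^ 2) atTop (𝓝 v)) :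
    TendstoNormal (gaussianSequence 𝕜)
      (fun n g => √((n + 1 : ℕ) : ℝ) * ∑ k : Fin (n + 1),
        ‖((‖initialVector 𝕜 (n + 1) g‖⁻¹ : ℝ) • initialVector 𝕜 (n + 1) g) k‖ ^ 2 * a n k)
      ((2 / dysonIndex 𝕜).toNNReal * v) := by
  have hβ := dysonIndex_pos 𝕜
  have hS := tendstoNormal_sum_normSq 𝕜 a C v ha ha0 hv
  have hDm (n : ℕ) : AEMeasurable
      (fun g : ℕ → 𝕜 => ((∑ k : Fin (n + 1), ‖g k‖ ^ 2) / ((n + 1 : ℕ) : ℝ))⁻¹)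
      (gaussianSequence 𝕜) := (Measurable.aemeasurable (by fun_prop))
  have hD : TendstoInMeasure (gaussianSequence 𝕜)
      (fun n g => ((∑ k : Fin (n + 1), ‖g k‖ ^ 2) / ((n + 1 : ℕ) : ℝ))⁻¹) atTop
      (fun _ => (dysonIndex 𝕜)⁻¹) := by
    refine tendstoInMeasure_of_tendsto_ae (fun n => (hDm n).aestronglyMeasurable) ?_
    filter_upwards [ae_tendsto_mean_normSq 𝕜] with g hg
    exact hg.inv₀ hβ.ne'
  have h := TendstoInDistribution.continuous_comp_prodMk_of_tendstoInMeasure_const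
    (g := fun p : ℝ × ℝ => p.1 * p.2) (by fun_prop) hS hD hDm
  have h' := TendstoNormal.of_map_eq (v := (2 / dysonIndex 𝕜).toNNReal * v) h (by
    have := gaussianReal_map_mul_const (μ := 0) (v := (2 * dysonIndex 𝕜).toNNReal * v)
      (dysonIndex 𝕜)⁻¹
    simp only [id]
    rw [this]
    congr 1
    · simp
    · ext
      simp only [NNReal.coe_mul, NNReal.coe_mk]
      rw [Real.coe_toNNReal _ (by positivity), Real.coe_toNNReal _ (by positivity)]
      field_simp)
  convert! h' using 3 with n g
  have hx : ‖initialVector 𝕜 (n + 1) g‖ ^ 2 = ∑ k : Fin (n + 1), ‖g k‖ ^ 2 :=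
    EuclideanSpace.norm_sq_eq _
  have hN : √((n + 1 : ℕ) : ℝ) ≠ 0 := by positivity
  have hN2 : √((n + 1 : ℕ) : ℝ) ^ 2 = ((n + 1 : ℕ) : ℝ) := Real.sq_sqrt (Nat.cast_nonneg _)
  have hterm (k : Fin (n + 1)) :
      ‖((‖initialVector 𝕜 (n + 1) g‖⁻¹ : ℝ) • initialVector 𝕜 (n + 1) g) k‖ ^ 2 =
        (∑ k : Fin (n + 1), ‖g k‖ ^ 2)⁻¹ * ‖g k‖ ^ 2 := by
    rw [PiLp.smul_apply, norm_smul, mul_pow, norm_inv, norm_norm, inv_pow, hx]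
    rfl
  simp only [hterm, mul_assoc]
  rw [← Finset.mul_sum, inv_div]
  field_simp
  rw [hN2, mul_comm]

end gaussian

/-! ### Transfer to Haar matrices with deterministic weights -/

section haar

variable {𝕜 : Type*} [RCLike 𝕜] (μ : ∀ n : ℕ, Measure (Matrix.unitaryGroup (Fin (n + 1)) 𝕜))
  [∀ n, IsProbabilityMeasure (μ n)] [∀ n, (μ n).IsMulLeftInvariant]
  (a : ∀ n : ℕ, Fin (n + 1) → ℝ) (C v : ℝ)

theorem tendsto_integral_cexp_firstRow (ha : ∀ n k, |a n k| ≤ C) (ha0 : ∀ n, ∑ k, a n k = 0)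
    (hv0 : 0 ≤ v)
    (hv : Tendsto (fun n : ℕ => (1 / ((n + 1 : ℕ) : ℝ)) * ∑ k, a n k ^ 2) atTop (𝓝 v)) (t : ℝ) :
    Tendsto (fun n => ∫ U : Matrix.unitaryGroup (Fin (n + 1)) 𝕜,
      Complex.exp (t * (√((n + 1 : ℕ) : ℝ) *
        ∑ k, ‖(U : Matrix (Fin (n + 1)) (Fin (n + 1)) 𝕜) 0 k‖ ^ 2 * a n k : ℝ) * Complex.I) ∂μ n)
      atTop (𝓝 (Complex.exp (-(2 / dysonIndex 𝕜 * v * t ^ 2 / 2 : ℝ)))) := by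
  have hβ := dysonIndex_pos 𝕜
  lift v to ℝ≥0 using hv0
  have h := (tendstoNormal_iff.1
    (tendstoNormal_normalized 𝕜 a C v ha ha0 hv)).2 t
  have hcoe : (((2 / dysonIndex 𝕜).toNNReal * v : ℝ≥0) : ℝ) = 2 / dysonIndex 𝕜 * v := by
    rw [NNReal.coe_mul, Real.coe_toNNReal _ (by positivity)]
  simp only [hcoe] at h
  refine h.congr fun n => ?_
  let F (x : EuclideanSpace 𝕜 (Fin (n + 1))) : ℂ :=
    Complex.exp (t * (√((n + 1 : ℕ) : ℝ) * ∑ k, ‖x k‖ ^ 2 * a n k : ℝ) * Complex.I)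
  have hF : Continuous F := by fun_prop
  have hnorm : Measurable fun x : EuclideanSpace 𝕜 (Fin (n + 1)) => (‖x‖⁻¹ : ℝ) • x := by fun_prop
  calc _ = ∫ g, F ((‖initialVector 𝕜 (n + 1) g‖⁻¹ : ℝ) • initialVector 𝕜 (n + 1) g)
        ∂gaussianSequence 𝕜 := rfl
    _ = ∫ x, F ((‖x‖⁻¹ : ℝ) • x) ∂stdGaussian (EuclideanSpace 𝕜 (Fin (n + 1))) := by
        rw [← map_initialVector]
        exact (integral_map (measurable_initialVector 𝕜 _).aemeasurable
          (hF.measurable.comp hnorm).aestronglyMeasurable).symm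
    _ = ∫ x, F x ∂(μ n).map firstRow := by
        rw [map_firstRow_eq, integral_map hnorm.aemeasurable hF.measurable.aestronglyMeasurable]
    _ = _ := integral_map continuous_firstRow.measurable.aemeasurable
        hF.measurable.aestronglyMeasurable

end haar

/-! ### Random eigenvalues -/

section main

variable {𝕜 : Type*} [RCLike 𝕜] (f : ℝ →ᵇ ℝ)

/-- The mean `(1/N) ∑ₖ f(x k)`. -/
noncomputable def sampleMean {N : ℕ} (x : Fin N → ℝ) : ℝ := 1 / (N : ℝ) * ∑ k, f (x k)

theorem measurable_sampleMean {N : ℕ} : Measurable (sampleMean f : (Fin N → ℝ) → ℝ) := by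
  have := f.continuous.measurable
  unfold sampleMean
  fun_prop

theorem abs_sampleMean_le {N : ℕ} [NeZero N] (x : Fin N → ℝ) : |sampleMean f x| ≤ ‖f‖ := by
  have hN : (0 : ℝ) < N := Nat.cast_pos.2 (NeZero.pos N)
  rw [sampleMean, abs_mul, abs_of_pos (by positivity), div_mul_eq_mul_div, one_mul, div_le_iff₀ hN]
  refine (Finset.abs_sum_le_sum_abs _ _).trans ?_
  refine (Finset.sum_le_card_nsmul _ _ ‖f‖ fun k _ => f.norm_coe_le_norm (x k)).trans_eq ?_
  simp [mul_comm]

theorem sum_sub_sampleMean {N : ℕ} [NeZero N] (x : Fin N → ℝ) :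
    ∑ k, (f (x k) - sampleMean f x) = 0 := by
  have hN : (N : ℝ) ≠ 0 := Nat.cast_ne_zero.2 (NeZero.ne N)
  rw [Finset.sum_sub_distrib, Finset.sum_const, Finset.card_univ, Fintype.card_fin, nsmul_eq_mul,
    sampleMean]
  field_simp
  ring

theorem mean_sq_sub_sampleMean {N : ℕ} [NeZero N] (x : Fin N → ℝ) :
    1 / (N : ℝ) * ∑ k, (f (x k) - sampleMean f x) ^ 2 =
      1 / (N : ℝ) * ∑ k, f (x k) ^ 2 - sampleMean f x ^ 2 := by
  have hN : (N : ℝ) ≠ 0 := Nat.cast_ne_zero.2 (NeZero.ne N)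
  have h : ∑ k, (f (x k) - sampleMean f x) ^ 2 =
      ∑ k, f (x k) ^ 2 - N * sampleMean f x ^ 2 := by
    have h1 : ∑ k, f (x k) = N * sampleMean f x := by rw [sampleMean]; field_simp
    have h2 : ∀ k, (f (x k) - sampleMean f x) ^ 2 =
        f (x k) ^ 2 - 2 * sampleMean f x * f (x k) + sampleMean f x ^ 2 := fun k => by ring
    simp only [h2]
    rw [Finset.sum_add_distrib, Finset.sum_sub_distrib, ← Finset.mul_sum, h1]
    simp
    ring
  rw [h]
  field_simp

/-- The rescaled fluctuation `√N ∑ₖ |U₁ₖ|² (f(x k) - (1/N) ∑ⱼ f(x j))`. -/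
noncomputable def rowFluctuation {N : ℕ} [NeZero N] (U : Matrix.unitaryGroup (Fin N) 𝕜)
    (x : Fin N → ℝ) : ℝ :=
  √(N : ℝ) * ∑ k, ‖(U : Matrix (Fin N) (Fin N) 𝕜) 0 k‖ ^ 2 * (f (x k) - sampleMean f x)

theorem measurable_rowFluctuation {N : ℕ} [NeZero N] {Ω : Type*} [MeasurableSpace Ω]
    {U : Ω → Matrix.unitaryGroup (Fin N) 𝕜} {x : Ω → Fin N → ℝ} (hU : Measurable U)
    (hx : Measurable x) : Measurable fun ω => rowFluctuation f (U ω) (x ω) := by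
  have hf := f.continuous.measurable
  have hm := (measurable_sampleMean f).comp hx
  unfold rowFluctuation
  refine Measurable.const_mul (Finset.measurable_fun_sum _ fun k _ => ?_) _
  refine ((measurable_norm_sq_entry k).comp hU).mul (Measurable.sub ?_ hm)
  fun_prop

theorem rowFluctuation_eq {N : ℕ} [NeZero N] (U : Matrix.unitaryGroup (Fin N) 𝕜) (x : Fin N → ℝ) :
    rowFluctuation f U x = √(N : ℝ) * (entryOne f (specMatrix U x) - sampleMean f x) := by
  rw [rowFluctuation, (ofReal_entryOne f U x).2]
  simp only [mul_sub]
  rw [Finset.sum_sub_distrib, ← Finset.sum_mul, sum_norm_sq_firstRow, one_mul, mul_sub]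

theorem tendsto_integral_cexp_rowFluctuation
    (μ : ∀ n : ℕ, Measure (Matrix.unitaryGroup (Fin (n + 1)) 𝕜))
    [∀ n, IsProbabilityMeasure (μ n)] [∀ n, (μ n).IsMulLeftInvariant]
    (ν : ProbabilityMeasure ℝ) (x : ∀ n : ℕ, Fin (n + 1) → ℝ)
    (hmean : Tendsto (fun n => ∫ y, f y ∂(empiricalMeasure (x n) : Measure ℝ)) atTop
      (𝓝 (∫ y, f y ∂(ν : Measure ℝ))))
    (hsq : Tendsto (fun n => ∫ y, f y ^ 2 ∂(empiricalMeasure (x n) : Measure ℝ)) atTop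
      (𝓝 (∫ y, f y ^ 2 ∂(ν : Measure ℝ)))) (t : ℝ) :
    Tendsto (fun n => ∫ U, Complex.exp (t * rowFluctuation f U (x n) * Complex.I) ∂μ n) atTop
      (𝓝 (Complex.exp (-(sigmaZeroSq 𝕜 ν f * t ^ 2 / 2 : ℝ)))) := by
  simp only [integral_empiricalMeasure] at hmean
  simp only [integral_empiricalMeasure (fun y => f y ^ 2)] at hsq
  have hv : Tendsto (fun n : ℕ => 1 / ((n + 1 : ℕ) : ℝ) *
      ∑ k, (f (x n k) - sampleMean f (x n)) ^ 2) atTop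
      (𝓝 (∫ y, f y ^ 2 ∂(ν : Measure ℝ) - (∫ y, f y ∂(ν : Measure ℝ)) ^ 2)) :=
    (hsq.sub (hmean.pow 2)).congr fun n => (mean_sq_sub_sampleMean f (x n)).symm
  exact tendsto_integral_cexp_firstRow μ (fun n k => f (x n k) - sampleMean f (x n)) (‖f‖ + ‖f‖) _
    (fun n k => (abs_sub _ _).trans
      (add_le_add (f.norm_coe_le_norm _) (abs_sampleMean_le f _)))
    (fun n => sum_sub_sampleMean f (x n))
    (ge_of_tendsto' hv fun n => by positivity) hv t

variable {Ω : Type*} [MeasurableSpace Ω] {P : Measure Ω} [IsProbabilityMeasure P]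

/-- Independence splits each term of ∑ |U₁ₖ|² f(λₖ), and E|U₁ₖ|² = 1/N. -/
theorem integral_entryOne_eq {N : ℕ} [NeZero N] {U : Ω → Matrix.unitaryGroup (Fin N) 𝕜}
    {x : Ω → Fin N → ℝ} (hU : Measurable U) (hx : Measurable x) (hindep : IndepFun U x P)
    (hhaar : (P.map U).IsMulLeftInvariant) :
    ∫ ω, entryOne f (specMatrix (U ω) (x ω)) ∂P = ∫ ω, sampleMean f (x ω) ∂P := by
  have := Measure.isProbabilityMeasure_map (μ := P) hU.aemeasurable
  have hf := f.continuous.measurable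
  have hUk (k : Fin N) : Measurable fun ω => ‖(U ω : Matrix (Fin N) (Fin N) 𝕜) 0 k‖ ^ 2 :=
    (measurable_norm_sq_entry k).comp hU
  have hfk (k : Fin N) : Measurable fun ω => f (x ω k) := by fun_prop
  have hfint (k : Fin N) : Integrable (fun ω => f (x ω k)) P :=
    Integrable.of_bound (hfk k).aestronglyMeasurable ‖f‖ (ae_of_all _ fun ω => f.norm_coe_le_norm _)
  have hmul (k : Fin N) :
      ∫ ω, ‖(U ω : Matrix (Fin N) (Fin N) 𝕜) 0 k‖ ^ 2 * f (x ω k) ∂P =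
        1 / (N : ℝ) * ∫ ω, f (x ω k) ∂P := by
    have hi : IndepFun (fun ω => ‖(U ω : Matrix (Fin N) (Fin N) 𝕜) 0 k‖ ^ 2)
        (fun ω => f (x ω k)) P :=
      hindep.comp (measurable_norm_sq_entry k) (hf.comp (measurable_pi_apply k))
    rw [hi.integral_fun_mul_eq_mul_integral (hUk k).aestronglyMeasurable
      (hfk k).aestronglyMeasurable, ← integral_norm_sq_entry (P.map U) k,
      integral_map hU.aemeasurable (measurable_norm_sq_entry k).aestronglyMeasurable]
  simp only [fun ω => (ofReal_entryOne f (U ω) (x ω)).2, sampleMean]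
  rw [integral_const_mul, integral_finsetSum _ fun k _ => hfint k, integral_finsetSum,
    Finset.mul_sum]
  · exact Finset.sum_congr rfl fun k _ => hmul k
  · intro k _
    refine Integrable.of_bound ((hUk k).mul (hfk k)).aestronglyMeasurable (1 * ‖f‖)
      (ae_of_all _ fun ω => ?_)
    rw [norm_mul, Real.norm_of_nonneg (sq_nonneg _)]
    exact mul_le_mul (norm_sq_entry_le_one _ _) (f.norm_coe_le_norm _) (norm_nonneg _) zero_le_one

theorem norm_cexp_real_mul_I (t y : ℝ) : ‖Complex.exp (t * y * Complex.I)‖ = 1 := by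
  rw [← Complex.ofReal_mul, Complex.norm_exp_ofReal_mul_I]

variable (U : ∀ n : ℕ, Ω → Matrix.unitaryGroup (Fin (n + 1)) 𝕜) (lam : ∀ n : ℕ, Ω → Fin (n + 1) → ℝ)

/-- Integrate over U first: `ψ n` is the characteristic function of the fluctuation given Λ, and it
tends almost surely to the constant c. The factor carrying `b n` has modulus 1, so dominated
convergence replaces `ψ n` by c whatever the joint behaviour of the two factors. -/
theorem tendsto_integral_cexp_add
    (hU : ∀ n, Measurable (U n)) (hlam : ∀ n, Measurable (lam n))
    (hindep : ∀ n, IndepFun (U n) (lam n) P) (hhaar : ∀ n, (P.map (U n)).IsMulLeftInvariant)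
    (ν : ProbabilityMeasure ℝ)
    (hmean : ∀ᵐ ω ∂P, Tendsto (fun n => ∫ x, f x ∂(empiricalMeasure (lam n ω) : Measure ℝ)) atTop
      (𝓝 (∫ x, f x ∂(ν : Measure ℝ))))
    (hsq : ∀ᵐ ω ∂P, Tendsto (fun n => ∫ x, f x ^ 2 ∂(empiricalMeasure (lam n ω) : Measure ℝ)) atTop
      (𝓝 (∫ x, f x ^ 2 ∂(ν : Measure ℝ))))
    (b : ∀ n : ℕ, (Fin (n + 1) → ℝ) → ℝ) (hb : ∀ n, Measurable (b n)) (t : ℝ) (l : ℂ)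
    (hl : Tendsto (fun n => ∫ ω, Complex.exp (t * b n (lam n ω) * Complex.I) ∂P) atTop (𝓝 l)) :
    Tendsto (fun n => ∫ ω, Complex.exp (t * (rowFluctuation f (U n ω) (lam n ω) +
      b n (lam n ω) : ℝ) * Complex.I) ∂P) atTop
      (𝓝 (Complex.exp (-(sigmaZeroSq 𝕜 ν f * t ^ 2 / 2 : ℝ)) * l)) := by
  have hprob (n : ℕ) : IsProbabilityMeasure (P.map (U n)) :=
    Measure.isProbabilityMeasure_map (hU n).aemeasurable
  have hprob' (n : ℕ) : IsProbabilityMeasure (P.map (lam n)) :=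
    Measure.isProbabilityMeasure_map (hlam n).aemeasurable
  set c := Complex.exp (-(sigmaZeroSq 𝕜 ν f * t ^ 2 / 2 : ℝ)) with hc
  let ψ (n : ℕ) (x : Fin (n + 1) → ℝ) : ℂ :=
    ∫ V, Complex.exp (t * rowFluctuation f V x * Complex.I) ∂P.map (U n)
  let e (n : ℕ) (x : Fin (n + 1) → ℝ) : ℂ := Complex.exp (t * b n x * Complex.I)
  have he (n : ℕ) : Measurable (e n) := by
    have := hb n
    fun_prop
  have hA (n : ℕ) : Measurable fun p : Matrix.unitaryGroup (Fin (n + 1)) 𝕜 × (Fin (n + 1) → ℝ) =>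
      Complex.exp (t * rowFluctuation f p.1 p.2 * Complex.I) := by
    have := measurable_rowFluctuation f
      (measurable_fst (α := Matrix.unitaryGroup (Fin (n + 1)) 𝕜) (β := Fin (n + 1) → ℝ))
      measurable_snd
    fun_prop
  have hψ (n : ℕ) : Measurable (ψ n) :=
    (StronglyMeasurable.integral_prod_left (hA n).stronglyMeasurable).measurable
  have hψ1 (n : ℕ) (x : Fin (n + 1) → ℝ) : ‖ψ n x‖ ≤ 1 := by
    refine (norm_integral_le_integral_norm _).trans_eq ?_
    simp [norm_cexp_real_mul_I]
  have hfub (n : ℕ) : ∫ ω, Complex.exp (t * (rowFluctuation f (U n ω) (lam n ω) +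
      b n (lam n ω) : ℝ) * Complex.I) ∂P = ∫ ω, ψ n (lam n ω) * e n (lam n ω) ∂P := by
    let G (p : Matrix.unitaryGroup (Fin (n + 1)) 𝕜 × (Fin (n + 1) → ℝ)) : ℂ :=
      Complex.exp (t * rowFluctuation f p.1 p.2 * Complex.I) * e n p.2
    have hG : Measurable G := (hA n).mul ((he n).comp measurable_snd)
    have hGint : Integrable G ((P.map (U n)).prod (P.map (lam n))) :=
      Integrable.of_bound hG.aestronglyMeasurable 1 (ae_of_all _ fun p => by
        simp [G, e, norm_cexp_real_mul_I])
    calc _ = ∫ ω, G (U n ω, lam n ω) ∂P := by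
          refine integral_congr_ae (ae_of_all _ fun ω => ?_)
          simp only [G, e, ← Complex.exp_add]
          congr 1
          push_cast
          ring
      _ = ∫ p, G p ∂P.map fun ω => (U n ω, lam n ω) :=
          (integral_map ((hU n).prodMk (hlam n)).aemeasurable hG.aestronglyMeasurable).symm
      _ = ∫ p, G p ∂(P.map (U n)).prod (P.map (lam n)) := by
          rw [(indepFun_iff_map_prod_eq_prod_map_map (hU n).aemeasurable
            (hlam n).aemeasurable).1 (hindep n)]
      _ = ∫ x, ψ n x * e n x ∂P.map (lam n) := by
          rw [integral_prod_symm _ hGint]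
          refine integral_congr_ae (ae_of_all _ fun x => ?_)
          exact integral_mul_const (e n x) _
      _ = _ := integral_map (hlam n).aemeasurable ((hψ n).mul (he n)).aestronglyMeasurable
  have hdct : Tendsto (fun n => ∫ ω, (ψ n (lam n ω) - c) * e n (lam n ω) ∂P) atTop (𝓝 0) := by
    rw [← integral_zero Ω ℂ (μ := P)]
    refine tendsto_integral_of_dominated_convergence (fun _ => 1 + ‖c‖)
      (fun n => ((((hψ n).comp (hlam n)).sub_const c).mul
        ((he n).comp (hlam n))).aestronglyMeasurable) (integrable_const _)
      (fun n => ae_of_all _ fun ω => ?_) ?_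
    · rw [norm_mul, norm_cexp_real_mul_I, mul_one]
      exact (norm_sub_le _ _).trans (by gcongr; exact hψ1 _ _)
    · filter_upwards [hmean, hsq] with ω h1 h2
      have h := tendsto_integral_cexp_rowFluctuation f (fun n => P.map (U n)) ν
        (fun n => lam n ω) h1 h2 t
      have h0 : Tendsto (fun n => ψ n (lam n ω) - c) atTop (𝓝 0) := by
        have h' := h.sub_const c
        rwa [← hc, sub_self] at h'
      rw [tendsto_zero_iff_norm_tendsto_zero] at h0 ⊢
      simpa only [norm_mul, e, norm_cexp_real_mul_I, mul_one] using h0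
  have hsum := hdct.add (hl.const_mul c)
  rw [zero_add] at hsum
  refine hsum.congr fun n => ?_
  have heint : Integrable (fun ω => e n (lam n ω)) P :=
    Integrable.of_bound ((he n).comp (hlam n)).aestronglyMeasurable 1 (ae_of_all _ fun ω =>
      (norm_cexp_real_mul_I _ _).le)
  have hψint : Integrable (fun ω => ψ n (lam n ω) * e n (lam n ω)) P :=
    Integrable.of_bound (((hψ n).comp (hlam n)).mul ((he n).comp (hlam n))).aestronglyMeasurable 1
      (ae_of_all _ fun ω => by
        rw [norm_mul, norm_cexp_real_mul_I, mul_one]; exact hψ1 _ _)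
  rw [hfub]
  simp only [sub_mul]
  rw [integral_sub hψint (heint.const_mul c), integral_const_mul]
  simp [e]

theorem TendstoNormal.div_sqrt {X : ℕ → Ω → ℝ} {v : ℝ≥0} (h : TendstoNormal P X v) :
    TendstoNormal P (fun n ω => X n ω * (√((n + 1 : ℕ) : ℝ))⁻¹) 0 := by
  have hlim : Tendsto (fun n : ℕ => (√((n + 1 : ℕ) : ℝ))⁻¹) atTop (𝓝 0) :=
    tendsto_inv_atTop_zero.comp
      (Real.tendsto_sqrt_atTop.comp (tendsto_natCast_atTop_atTop.comp (tendsto_add_atTop_nat 1)))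
  have hmeas : TendstoInMeasure P (fun (n : ℕ) (_ : Ω) => (√((n + 1 : ℕ) : ℝ))⁻¹) atTop
      (fun _ => 0) :=
    tendstoInMeasure_of_tendsto_ae (fun n => aestronglyMeasurable_const) (ae_of_all _ fun _ => hlim)
  have h2 := TendstoInDistribution.continuous_comp_prodMk_of_tendstoInMeasure_const
    (g := fun p : ℝ × ℝ => p.1 * p.2) (by fun_prop) h hmeas (fun n => aemeasurable_const)
  refine TendstoNormal.of_map_eq h2 ?_
  simp

end main

end SpectralCLT

theorem mainTheorem3
    {𝕜 : Type*} [RCLike 𝕜]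
    {Ω : Type*} [MeasurableSpace Ω] (P : Measure Ω) [IsProbabilityMeasure P]
    -- the matrices for index `n` have size `n + 1`
    (U : ∀ n : ℕ, Ω → Matrix.unitaryGroup (Fin (n + 1)) 𝕜)
    (lam : ∀ n : ℕ, Ω → Fin (n + 1) → ℝ)
    (hU : ∀ n, Measurable (U n)) (hlam : ∀ n, Measurable (lam n))
    -- (A1)
    (hindep : ∀ n, IndepFun (U n) (lam n) P)
    (hhaar : ∀ n, (P.map (U n)).IsHaarMeasure)
    (f : ℝ →ᵇ ℝ)
    -- (A2)
    (ν : ProbabilityMeasure ℝ)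
    (hweak : ∀ᵐ ω ∂P, Tendsto (fun n => empiricalMeasure (lam n ω)) atTop (𝓝 ν))
    (hmean : ∀ᵐ ω ∂P, Tendsto (fun n => ∫ x, f x ∂(empiricalMeasure (lam n ω) : Measure ℝ)) atTop
      (𝓝 (∫ x, f x ∂(ν : Measure ℝ))))
    (hsq : ∀ᵐ ω ∂P, Tendsto (fun n => ∫ x, f x ^ 2 ∂(empiricalMeasure (lam n ω) : Measure ℝ)) atTop
      (𝓝 (∫ x, f x ^ 2 ∂(ν : Measure ℝ)))) :
    TendstoNormal P
      (fun n ω => √((n + 1 : ℕ) : ℝ) *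
        (entryOne f (specMatrix (U n ω) (lam n ω)) -
          1 / ((n + 1 : ℕ) : ℝ) * traceFun f (specMatrix (U n ω) (lam n ω))))
      (sigmaZeroSq 𝕜 ν f).toNNReal ∧
    (∀ sigmaHatSq : ℝ≥0,
      TendstoNormal P
        (fun n ω => √((n + 1 : ℕ) : ℝ) *
          (∫ x, f x ∂(empiricalMeasure (lam n ω) : Measure ℝ) -
            ∫ ω', ∫ x, f x ∂(empiricalMeasure (lam n ω') : Measure ℝ) ∂P))
        sigmaHatSq →
      TendstoNormal P
        (fun n ω => √((n + 1 : ℕ) : ℝ) *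
          (entryOne f (specMatrix (U n ω) (lam n ω)) -
            ∫ ω', entryOne f (specMatrix (U n ω') (lam n ω')) ∂P))
        ((sigmaZeroSq 𝕜 ν f).toNNReal + sigmaHatSq)) ∧
    -- (A3)
    ((∃ sigmaOneSq : ℝ≥0, TendstoNormal P
        (fun n ω => traceFun f (specMatrix (U n ω) (lam n ω)) -
          ∫ ω', traceFun f (specMatrix (U n ω') (lam n ω')) ∂P)
        sigmaOneSq) →
      TendstoNormal P
        (fun n ω => √((n + 1 : ℕ) : ℝ) *
          (∫ x, f x ∂(empiricalMeasure (lam n ω) : Measure ℝ) -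
            ∫ ω', ∫ x, f x ∂(empiricalMeasure (lam n ω') : Measure ℝ) ∂P))
        0 ∧
      TendstoNormal P
        (fun n ω => √((n + 1 : ℕ) : ℝ) *
          (entryOne f (specMatrix (U n ω) (lam n ω)) -
            ∫ ω', entryOne f (specMatrix (U n ω') (lam n ω')) ∂P))
        (sigmaZeroSq 𝕜 ν f).toNNReal) := by
  have hhaar' (n : ℕ) : (P.map (U n)).IsMulLeftInvariant := (hhaar n).toIsMulLeftInvariant
  have hA (n : ℕ) : Measurable fun ω => rowFluctuation f (U n ω) (lam n ω) :=
    measurable_rowFluctuation f (hU n) (hlam n)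
  have hσ : ((sigmaZeroSq 𝕜 ν f).toNNReal : ℝ) = sigmaZeroSq 𝕜 ν f :=
    Real.coe_toNNReal _ (sigmaZeroSq_nonneg 𝕜 ν f)
  have hemp (n : ℕ) (ω : Ω) : ∫ x, f x ∂(empiricalMeasure (lam n ω) : Measure ℝ) =
      sampleMean f (lam n ω) := integral_empiricalMeasure f (lam n ω)
  have htr (n : ℕ) (ω : Ω) : 1 / ((n + 1 : ℕ) : ℝ) * traceFun f (specMatrix (U n ω) (lam n ω)) =
      sampleMean f (lam n ω) := by
    rw [(ofReal_traceFun f (U n ω) (lam n ω)).2, sampleMean]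
  have hE (n : ℕ) : ∫ ω, entryOne f (specMatrix (U n ω) (lam n ω)) ∂P =
      ∫ ω, sampleMean f (lam n ω) ∂P :=
    integral_entryOne_eq f (hU n) (hlam n) (hindep n) (hhaar' n)
  have part2 : ∀ sigmaHatSq : ℝ≥0,
      TendstoNormal P
        (fun n ω => √((n + 1 : ℕ) : ℝ) *
          (∫ x, f x ∂(empiricalMeasure (lam n ω) : Measure ℝ) -
            ∫ ω', ∫ x, f x ∂(empiricalMeasure (lam n ω') : Measure ℝ) ∂P))
        sigmaHatSq →
      TendstoNormal P
        (fun n ω => √((n + 1 : ℕ) : ℝ) *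
          (entryOne f (specMatrix (U n ω) (lam n ω)) -
            ∫ ω', entryOne f (specMatrix (U n ω') (lam n ω')) ∂P))
        ((sigmaZeroSq 𝕜 ν f).toNNReal + sigmaHatSq) := by
    intro s hs
    simp only [hemp] at hs
    let b (n : ℕ) (x : Fin (n + 1) → ℝ) : ℝ :=
      √((n + 1 : ℕ) : ℝ) * (sampleMean f x - ∫ ω, sampleMean f (lam n ω) ∂P)
    have hb (n : ℕ) : Measurable (b n) := ((measurable_sampleMean f).sub_const _).const_mul _
    have heq (n : ℕ) (ω : Ω) : √((n + 1 : ℕ) : ℝ) *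
        (entryOne f (specMatrix (U n ω) (lam n ω)) -
          ∫ ω', entryOne f (specMatrix (U n ω') (lam n ω')) ∂P) =
        rowFluctuation f (U n ω) (lam n ω) + b n (lam n ω) := by
      rw [hE, rowFluctuation_eq]
      ring
    simp only [heq]
    refine tendstoNormal_iff.2
      ⟨fun n => ((hA n).add ((hb n).comp (hlam n))).aemeasurable, fun t => ?_⟩
    have h := tendsto_integral_cexp_add f U lam hU hlam hindep hhaar' ν hmean hsq b hb t _
      ((tendstoNormal_iff.1 hs).2 t)
    rw [← Complex.exp_add] at h
    convert! h using 3
    rw [NNReal.coe_add, hσ]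
    push_cast
    ring
  refine ⟨?_, part2, ?_⟩
  · simp only [htr, ← rowFluctuation_eq]
    refine tendstoNormal_iff.2 ⟨fun n => (hA n).aemeasurable, fun t => ?_⟩
    have h := tendsto_integral_cexp_add f U lam hU hlam hindep hhaar' ν hmean hsq
      (fun _ _ => 0) (fun _ => measurable_const) t 1 (by simp)
    simpa [hσ] using h
  · rintro ⟨s, hs⟩
    have h0 : TendstoNormal P
        (fun n ω => √((n + 1 : ℕ) : ℝ) *
          (∫ x, f x ∂(empiricalMeasure (lam n ω) : Measure ℝ) -
            ∫ ω', ∫ x, f x ∂(empiricalMeasure (lam n ω') : Measure ℝ) ∂P)) 0 := by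
      -- √N · (1/N) = 1/√N turns the scaled empirical mean into the trace divided by √N.
      have heq (n : ℕ) (ω : Ω) : √((n + 1 : ℕ) : ℝ) *
          (∫ x, f x ∂(empiricalMeasure (lam n ω) : Measure ℝ) -
            ∫ ω', ∫ x, f x ∂(empiricalMeasure (lam n ω') : Measure ℝ) ∂P) =
          (traceFun f (specMatrix (U n ω) (lam n ω)) -
            ∫ ω', traceFun f (specMatrix (U n ω') (lam n ω')) ∂P) *
              (√((n + 1 : ℕ) : ℝ))⁻¹ := by
        have hN : √((n + 1 : ℕ) : ℝ) ≠ 0 := by positivity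
        have hN2 : √((n + 1 : ℕ) : ℝ) ^ 2 = ((n + 1 : ℕ) : ℝ) := Real.sq_sqrt (Nat.cast_nonneg _)
        simp only [hemp, ← htr]
        rw [integral_const_mul, ← mul_sub]
        field_simp
        rw [hN2]
      simp only [heq]
      exact hs.div_sqrt
    exact ⟨h0, by simpa using part2 0 h0⟩
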